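/- **Setting.** Let $1<p\le\infty$, $\frac1p+\frac1q=1$, and let $\mathcal C\subset\mathbb R^d$ be compact and convex with $0\in\mathcal C$ and $\ell_p$-diameter at most $D$. Let $f:\mathcal C\times\mathcal X\to\mathbb R$ be differentiable in $\theta\in\mathcal C$, with $\|\nabla f(\theta_1,x)-\nabla f(\theta_2,x)\|_q\le\beta\|\theta_1-\theta_2\|_p$ and $\|\nabla f(\theta,x)\|_q\le L$ for all $\theta,\theta_1,\theta_2\in\mathcal C$, $x\in\mathcal X$, where $\beta\ge0$. Suppose that $\|\cdot\|_q$ is $\kappa_q$-regular with associated smooth norm $\|\cdot\|_{+}$: there is $1\le\kappa_+\le\kappa_q$ such that $\|x\|_q^2\le\|x\|_{+}^2\le\frac{\kappa_q}{\kappa_+}\|x\|_q^2$ for all $x$, $\|\cdot\|_{+}^2$ is differentiable, and $\|x+y\|_{+}^2\le\|x\|_{+}^2+\langle\nabla\|\cdot\|_{+}^2(x),y\rangle+\kappa_+\|y\|_{+}^2$ for all $x,y$. Let $\mathcal G_{\|\cdot\|_+}(0,\sigma^2)$ be the probability distribution on $\mathbb R^d$ with density proportional to $\exp(-\|z\|_{+}^2/(2\sigma^2))$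 (the point mass at $0$ if $\sigma=0$). **Algorithm DP-TOFW** on a dataset $(x_1,\dots,x_n)$ with noise level $\sigma_+^2$. Put $\theta_0=\theta_1=0$ and take a complete binary tree of height $\lceil\log_2 n\rceil$ all of whose nodes store $0$; the first $n$ leaves correspond to the times $1,\dots,n$, and the root counts as a left child. For $t=1,\dots,n$: 1. Let $g_t=(t+1)\nabla f(\theta_t;x_t)-t\nabla f(\theta_{t-1};x_t)$. Add $g_t$ to every node on the path from leaf $t$ to the root, and add an independent draw of $\mathcal G_{\|\cdot\|_+}(0,\sigma_+^2)$ to every node on this path up to and including its first left child. 2. For every $h$ for which the bit of weight $2^h$ in the binary representation of $t$ is $1$, take the node of height $h$ on this path if it is a left child, and otherwise its left sibling. Let $\tilde G_t$ be the sum of the values stored in the nodes taken. 3. Let $d_t=\tilde G_t/(t+1)$, $v_t\in\arg\min_{v\in\mathcal C}\langle d_t,v\rangle$ (with any fixed measurable rule for ties) and $\theta_{t+1}=\theta_t+\frac1{1+t}(v_t-\theta_t)$. The output is the whole sequence $(\theta_1,\dots,\theta_{n+1})$. **Theorem (privacy guarantee).** Let $n\ge2$, $0<\delta<1$ and $0<\varepsilon\le(\lceil\log_2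 n\rceil+1)\log\frac{\lceil\log_2 n\rceil+1}{\delta}$. If $$\sigma_+^2=\frac{8(\lceil\log_2 n\rceil+1)^2\,\kappa_q\,\log\big((\lceil\log_2 n\rceil+1)/\delta\big)(\beta D+L)^2}{\varepsilon^2},$$ then DP-TOFW is $(\varepsilon,\delta)$-differentially private: for any two datasets $\mathcal D,\mathcal D'$ of size $n$ that differ in one entry and any measurable set $\mathcal E$ of output sequences, $\mathbb P[\mathcal A(\mathcal D)\in\mathcal E]\le e^{\varepsilon}\,\mathbb P[\mathcal A(\mathcal D')\in\mathcal E]+\delta$. -/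

import Mathlib

open MeasureTheory

namespace DPTOFW

/-- `ℝ^d` with its standard inner product and Lebesgue measure. The `ℓ_p` norms used below are
the explicit functions `lpNorm p`. -/
abbrev Vec (d : ℕ) := EuclideanSpace ℝ (Fin d)

/-- The `ℓ_p` norm of a vector of `ℝ^d`, for an extended exponent `p`. -/
noncomputable def lpNorm {d : ℕ} (p : ENNReal) (x : Vec d) : ℝ :=
  ‖(WithLp.toLp p (fun i => x i) : PiLp p (fun _ : Fin d => ℝ))‖

/-! ### Regular norms -/

/-- The norm `N` is `κ`-smooth: `N²` is differentiable and
`N (x + y)² ≤ N x² + D(N²)(x) y + κ N y²` (equivalently, the gradient of `N² / 2` is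
`κ`-Lipschitz from `N` to its dual norm). -/
def IsSmoothNorm {d : ℕ} (κ : ℝ) (N : Seminorm ℝ (Vec d)) : Prop :=
  Differentiable ℝ (fun x => N x ^ 2) ∧
    ∀ x y, N (x + y) ^ 2 ≤ N x ^ 2 + fderiv ℝ (fun z => N z ^ 2) x y + κ * N y ^ 2

/-- The norm `M` is `κ`-regular with associated smooth norm `N`. (If `M` is a norm, the left-hand
inequality forces the seminorm `N` to be a norm.) -/
def IsRegularNorm {d : ℕ} (κ : ℝ) (M : Vec d → ℝ) (N : Seminorm ℝ (Vec d)) : Prop :=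
  ∃ κ' : ℝ, 1 ≤ κ' ∧ κ' ≤ κ ∧ IsSmoothNorm κ' N ∧
    ∀ x, M x ^ 2 ≤ N x ^ 2 ∧ N x ^ 2 ≤ κ / κ' * M x ^ 2

/-! ### Generalized Gaussian noise -/

/-- The unnormalized generalized Gaussian: density `exp (-N (z - m)² / (2 v))` with respect to
Lebesgue measure. -/
noncomputable def gaussianWeight {d : ℕ} (N : Seminorm ℝ (Vec d)) (m : Vec d) (v : ℝ) :
    Measure (Vec d) :=
  volume.withDensity fun z => ENNReal.ofReal (Real.exp (-(N (z - m) ^ 2) / (2 * v)))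

/-- The generalized Gaussian distribution `𝒢_N(m, v)`: the probability measure with density
proportional to `exp (-N (z - m)² / (2 v))`; for `v = 0` it is the point mass at `m`. -/
noncomputable def generalizedGaussian {d : ℕ} (N : Seminorm ℝ (Vec d)) (m : Vec d) (v : ℝ) :
    Measure (Vec d) :=
  if v = 0 then Measure.dirac m
  else (gaussianWeight N m v Set.univ)⁻¹ • gaussianWeight N m v

/-! ### Tree-based aggregation

The complete binary tree of height `H` has the nodes `(h, j)`, `h ≤ H`, `j < 2 ^ (H - h)`: the
`j`-th node (from the left, starting at `0`) at height `h` above the leaves, so it has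
`2 ^ (H + 1) - 1` nodes. The children of `(h + 1, j)` are `(h, 2 * j)` and `(h, 2 * j + 1)`.
The `t`-th element of the stream belongs to the leaf `(0, t - 1)`, whose path to the root consists
of the nodes `(h, (t - 1) / 2 ^ h)`, `h = 0, …, H`. -/

/-- The index of the node at height `h` on the path from the leaf of time `t` to the root. -/
def pathIndex (t h : ℕ) : ℕ := (t - 1) / 2 ^ h

/-- The node `(h, j)` is a left child iff `j` is even (the root counts as a left child). -/
abbrev IsLeftIndex (j : ℕ) : Prop := Even j

/-- The path node of height `h` lies between the leaf of time `t` and the first left child on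
its path (both included): no earlier node of the path is a left child. -/
abbrev UpToFirstLeft (t h : ℕ) : Prop := ∀ h' < h, ¬ IsLeftIndex (pathIndex t h')

/-- Tree update at time `t`: `z` is added to every node on the path of `t`, and fresh noise `ξ h`
to the nodes of the path up to the first left child. -/
def treeUpdate {V : Type*} [AddCommMonoid V] (H t : ℕ) (z : V) (ξ : Fin (H + 1) → V)
    (A : ℕ → ℕ → V) : ℕ → ℕ → V := fun h j =>
  if hh : h < H + 1 then
    if j = pathIndex t h then
      A h j + z + (if UpToFirstLeft t h then ξ ⟨h, hh⟩ else 0)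
    else A h j
  else A h j

/-- Private partial sum at time `t`: for every bit `h` equal to `1` in the binary representation
of `t`, add the path node of height `h` if it is a left child, else its left sibling. -/
def noisyPartialSum {V : Type*} [AddCommMonoid V] (H t : ℕ) (A : ℕ → ℕ → V) : V :=
  ∑ h ∈ Finset.range (H + 1),
    if t.testBit h then
      (if IsLeftIndex (pathIndex t h) then A h (pathIndex t h) else A h (pathIndex t h - 1))
    else 0

/-! ### The algorithm -/

/-- State after time `t`: the iterates `θ_t`, `θ_{t+1}` and the current content of the tree. -/
structure State (d : ℕ) where
  prev : Vec d
  cur : Vec d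
  tree : ℕ → ℕ → Vec d

/-- The initial state: `θ_0 = θ_1 = 0` and an empty tree. -/
def State.init (d : ℕ) : State d := ⟨0, 0, fun _ _ => 0⟩

/-- The recursive gradient increment `g_t = (t + 1) ∇f(θ_t; x_t) - t ∇f(θ_{t-1}; x_t)`. -/
noncomputable def gradIncrement {d : ℕ} {X : Type*} (gradf : Vec d → X → Vec d) (t : ℕ) (x : X)
    (θprev θ : Vec d) : Vec d :=
  ((t : ℝ) + 1) • gradf θ x - (t : ℝ) • gradf θprev x

/-- Iteration `t` of the algorithm on the sample `x = x_t`, with the noise draws `ξ` of that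
iteration: update the tree with `g_t`, read off the noisy sum `G_t`, put `d_t = G_t / (t + 1)`,
`v_t = lmo d_t` and `θ_{t+1} = θ_t + (v_t - θ_t) / (1 + t)`. -/
noncomputable def State.step {d : ℕ} {X : Type*} (gradf : Vec d → X → Vec d)
    (lmo : Vec d → Vec d) (H t : ℕ) (x : X) (ξ : Fin (H + 1) → Vec d) (S : State d) : State d :=
  let g := gradIncrement gradf t x S.prev S.cur
  let A := treeUpdate H t g ξ S.tree
  let dt := (1 / ((t : ℝ) + 1)) • noisyPartialSum H t A
  { prev := S.cur
    cur := S.cur + (1 / (1 + (t : ℝ))) • (lmo dt - S.cur)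
    tree := A }

/-- The height `⌈log₂ n⌉` of the tree. -/
def height (n : ℕ) : ℕ := Nat.clog 2 n

/-- All noise draws of a run: one for every time and every height. -/
abbrev Noise (d n : ℕ) := Fin n × Fin (height n + 1) → Vec d

/-- The state after `t ≤ n` iterations on the dataset `x = (x_1, …, x_n)` (`x ⟨t, _⟩` is
`x_{t+1}`). -/
noncomputable def run {d n : ℕ} {X : Type*} (gradf : Vec d → X → Vec d) (lmo : Vec d → Vec d)
    (x : Fin n → X) (ω : Noise d n) : (t : ℕ) → t ≤ n → State d
  | 0, _ => State.init d
  | t + 1, ht => (run gradf lmo x ω t (Nat.le_of_succ_le ht)).step gradf lmo (height n) (t + 1)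
      (x ⟨t, ht⟩) (fun h => ω (⟨t, ht⟩, h))

/-- The sequence of iterates `θ_1, …, θ_{n+1}` (the entry with index `t` is `θ_{t+1}`). -/
noncomputable def iterates {d n : ℕ} {X : Type*} (gradf : Vec d → X → Vec d)
    (lmo : Vec d → Vec d) (x : Fin n → X) (ω : Noise d n) : Fin (n + 1) → Vec d :=
  fun t => (run gradf lmo x ω t (Nat.le_of_lt_succ t.isLt)).cur

/-- The law of the noise: independent draws from `𝒢_N(0, v)`. -/
noncomputable def noiseLaw {d : ℕ} (n : ℕ) (N : Seminorm ℝ (Vec d)) (v : ℝ) :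
    Measure (Noise d n) :=
  Measure.pi fun _ => generalizedGaussian N 0 v

/-- DP-TOFW with noise level `v = σ₊²` as a randomized algorithm: it maps a dataset to the joint
law of all its iterates. -/
noncomputable def tofw {d n : ℕ} {X : Type*} (gradf : Vec d → X → Vec d) (lmo : Vec d → Vec d)
    (N : Seminorm ℝ (Vec d)) (v : ℝ) (x : Fin n → X) : Measure (Fin (n + 1) → Vec d) :=
  (noiseLaw n N v).map (iterates gradf lmo x)

/-- `lmo` is a (measurable) choice of `arg min_{v ∈ C} ⟨g, v⟩`. -/
def IsLinearMinimizer {d : ℕ} (C : Set (Vec d)) (lmo : Vec d → Vec d) : Prop :=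
  Measurable lmo ∧ ∀ g, lmo g ∈ C ∧ ∀ v ∈ C, inner ℝ g (lmo g) ≤ inner ℝ g v

/-! ### Differential privacy -/

/-- `(ε, δ)`-differential privacy of a randomized algorithm, given by its output laws, on datasets
of size `n`; neighbours agree in all entries but one. -/
def IsDP {n : ℕ} {X Y : Type*} [MeasurableSpace Y] (M : (Fin n → X) → Measure Y) (ε δ : ℝ) :
    Prop :=
  (∀ x, IsProbabilityMeasure (M x)) ∧
    ∀ x x' : Fin n → X, (∃ i, ∀ j, j ≠ i → x j = x' j) → ∀ S : Set Y, MeasurableSet S →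
      M x S ≤ ENNReal.ofReal (Real.exp ε) * M x' S + ENNReal.ofReal δ

/-- The noise level `σ₊² = 8 (⌈log₂ n⌉ + 1)² κ log ((⌈log₂ n⌉ + 1) / δ) (β D + L)² / ε²`. -/
noncomputable def noiseLevel (n : ℕ) (κ β D L ε δ : ℝ) : ℝ :=
  8 * ((height n : ℝ) + 1) ^ 2 * κ * Real.log (((height n : ℝ) + 1) / δ) * (β * D + L) ^ 2 / ε ^ 2

end DPTOFW

namespace DPTOFW

/-! ### Shifts of product measures -/

/-! The proof couples the two runs through their noise. If the datasets differ in entry `i`, let `u`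
be the difference of the increments that the two samples give at time `i + 1`. A tree node receives
its noise only at the last time it covers, and partial sums read only nodes completed by then. So
adding `u` to the draws of the nodes above that leaf makes the run on `x'` reproduce every iterate
of the run on `x` (`iterates_shiftNoise`).

The shift `u` is random, but it depends only on noise drawn before time `i + 1`, while the shifted
draws come at time `i + 1` or later. Conditioning on the unshifted coordinates makes it a constant
(`pi_adaptive_shift_le`).

What remains is a fixed shift of at most `height n + 1` independent draws, one per height. The step
size `1 / (t + 1)` offsets the weights in the increment, whence `u` has `ℓ_q` norm at most `2 (β D +
L)` (`lpNorm_incrementAt_le`). Smoothness of `N²` bounds the exponential moments of the privacy loss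
as for a Gaussian (`lintegral_exp_loss_le`), and Chernoff's bound for the summed loss gives `(ε, δ)`
(`pi_shift_le`). -/

lemma lintegral_pi_prod {ι : Type*} [Fintype ι] {E : Type*} [MeasurableSpace E]
    (μ : Measure E) [IsProbabilityMeasure μ] (f : ι → E → ENNReal) (hf : ∀ i, Measurable (f i)) :
    ∫⁻ x, ∏ i, f i (x i) ∂(Measure.pi fun _ : ι => μ) = ∏ i, ∫⁻ x, f i x ∂μ := by
  have hind : ProbabilityTheory.iIndepFun (fun i (x : ι → E) => f i (x i))
      (Measure.pi fun _ : ι => μ) :=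
    ProbabilityTheory.iIndepFun_pi (X := f) fun i => (hf i).aemeasurable
  rw [ProbabilityTheory.lintegral_prod_eq_prod_lintegral_of_indepFun Finset.univ _ hind
    (fun i => (hf i).comp (measurable_pi_apply i))]
  refine Finset.prod_congr rfl fun i _ => ?_
  exact (measurePreserving_eval (fun _ : ι => μ) i).lintegral_comp (hf i)

lemma pi_withDensity {ι : Type*} [Fintype ι] {E : Type*} [MeasurableSpace E]
    (μ : Measure E) [IsProbabilityMeasure μ] (f : E → ENNReal) (hf : Measurable f)
    [SigmaFinite (μ.withDensity f)] :
    (Measure.pi fun _ : ι => μ.withDensity f)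
      = (Measure.pi fun _ : ι => μ).withDensity fun x => ∏ i, f (x i) := by
  refine Measure.pi_eq fun s hs => ?_
  rw [withDensity_apply _ (MeasurableSet.univ_pi hs),
    ← lintegral_indicator (MeasurableSet.univ_pi hs)]
  have h : ∀ x : ι → E, (Set.univ.pi s).indicator (fun x => ∏ i, f (x i)) x
      = ∏ i, (s i).indicator f (x i) := by
    intro x
    by_cases hx : x ∈ Set.univ.pi s
    · rw [Set.indicator_of_mem hx]
      exact Finset.prod_congr rfl fun i _ => (Set.indicator_of_mem (hx i trivial) f).symm
    · rw [Set.indicator_of_notMem hx]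
      obtain ⟨i, hi⟩ : ∃ i, x i ∉ s i := by simpa [Set.mem_pi] using hx
      exact (Finset.prod_eq_zero (Finset.mem_univ i) (Set.indicator_of_notMem hi f)).symm
  simp_rw [h]
  rw [lintegral_pi_prod μ (fun i => (s i).indicator f) fun i => hf.indicator (hs i)]
  refine Finset.prod_congr rfl fun i _ => ?_
  rw [lintegral_indicator (hs i), withDensity_apply _ (hs i)]

/-- If `loss` is the privacy loss of shifting `μ` by `w`, an exponential moment bound for `loss`
gives approximate indistinguishability of the product measure and its diagonal shift. -/
lemma pi_shift_le {ι : Type*} [Fintype ι] {E : Type*} [MeasurableSpace E] [Add E]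
    [MeasurableAdd E] (μ : Measure E) [IsProbabilityMeasure μ] (w : E) (loss : E → ℝ)
    (hloss : Measurable loss)
    (hmap : (μ.withDensity fun z => ENNReal.ofReal (Real.exp (-loss z))).map (fun z => z + w) = μ)
    {lam c ε δ : ℝ} (hlam : 0 < lam)
    (hmgf : ∫⁻ z, ENNReal.ofReal (Real.exp (lam * loss z)) ∂μ ≤ ENNReal.ofReal (Real.exp c))
    (hδ : Real.exp (Fintype.card ι * c - lam * ε) ≤ δ)
    (F : Set (ι → E)) (hF : MeasurableSet F) :
    (Measure.pi fun _ : ι => μ) {ω | (fun i => ω i + w) ∈ F}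
      ≤ ENNReal.ofReal (Real.exp ε) * (Measure.pi fun _ : ι => μ) F + ENNReal.ofReal δ := by
  set ν := Measure.pi fun _ : ι => μ with hν
  let Loss : (ι → E) → ℝ := fun ω => ∑ i, loss (ω i)
  have hLoss : Measurable Loss :=
    Finset.measurable_sum _ fun i _ => hloss.comp (measurable_pi_apply i)
  have hdm : Measurable fun z => ENNReal.ofReal (Real.exp (-loss z)) :=
    (Real.measurable_exp.comp hloss.neg).ennreal_ofReal
  have hT : Measurable fun (ω : ι → E) i => ω i + w :=
    measurable_pi_lambda _ fun i => (measurable_add_const w).comp (measurable_pi_apply i)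
  have hexp : ∀ (a : ℝ) (ω : ι → E), ∏ i, ENNReal.ofReal (Real.exp (a * loss (ω i)))
      = ENNReal.ofReal (Real.exp (a * Loss ω)) := by
    intro a ω
    rw [← ENNReal.ofReal_prod_of_nonneg fun i _ => (Real.exp_pos _).le, ← Real.exp_sum,
      Finset.mul_sum]
  -- Push-forward preserves total mass; this supplies the σ-finiteness needed by `pi_withDensity`.
  have hprob : IsProbabilityMeasure (μ.withDensity fun z => ENNReal.ofReal (Real.exp (-loss z))) :=
    ⟨by
      have h := congrArg (fun m : Measure E => m Set.univ) hmap
      simpa [Measure.map_apply (measurable_add_const w) MeasurableSet.univ] using h⟩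
  have hpi : (ν.withDensity fun ω => ENNReal.ofReal (Real.exp (-Loss ω))).map
      (fun ω i => ω i + w) = ν := by
    have h1 : (fun ω : ι → E => ENNReal.ofReal (Real.exp (-Loss ω)))
        = fun ω => ∏ i, ENNReal.ofReal (Real.exp (-loss (ω i))) := by
      funext ω
      simpa using (hexp (-1) ω).symm
    have hsf : ∀ _ : ι, SigmaFinite ((μ.withDensity fun z =>
        ENNReal.ofReal (Real.exp (-loss z))).map fun z => z + w) := fun _ => by
      rw [hmap]; infer_instance
    rw [h1, hν, ← pi_withDensity μ _ hdm, Measure.pi_map_pi (hμ := hsf)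
      (f := fun _ z => z + w) fun _ => (measurable_add_const w).aemeasurable]
    simp_rw [hmap]
  -- Where the loss is at most `ε`, the integrand satisfies `1 ≤ exp ε * exp (-Loss)`.
  have hgood : ν ({ω | (fun i => ω i + w) ∈ F} ∩ {ω | Loss ω ≤ ε})
      ≤ ENNReal.ofReal (Real.exp ε) * ν F := by
    have hFm : MeasurableSet {ω : ι → E | (fun i => ω i + w) ∈ F} := hT hF
    have hlm : MeasurableSet {ω | Loss ω ≤ ε} := measurableSet_le hLoss measurable_const
    have e1 : ν F = ∫⁻ ω in {ω | (fun i => ω i + w) ∈ F},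
        ENNReal.ofReal (Real.exp (-Loss ω)) ∂ν := by
      conv_lhs => rw [← hpi]
      rw [Measure.map_apply hT hF, withDensity_apply _ (hT hF)]
      rfl
    have hdL : Measurable fun ω => ENNReal.ofReal (Real.exp (-Loss ω)) :=
      (Real.measurable_exp.comp hLoss.neg).ennreal_ofReal
    rw [e1, ← lintegral_const_mul _ hdL,
      ← setLIntegral_one]
    refine (setLIntegral_mono' (hFm.inter hlm) fun ω hω => ?_).trans
      (lintegral_mono_set Set.inter_subset_left)
    rw [← ENNReal.ofReal_mul (Real.exp_pos _).le, ← Real.exp_add, ← ENNReal.ofReal_one]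
    refine ENNReal.ofReal_le_ofReal (Real.one_le_exp ?_)
    have : Loss ω ≤ ε := hω.2
    linarith
  -- Chernoff: Markov's inequality for `exp (lam * Loss)`, whose moment factorizes over the
  -- coordinates.
  have hbad : ν {ω | ε < Loss ω} ≤ ENNReal.ofReal δ := by
    have h1 : {ω | ε < Loss ω} ⊆ {ω | ENNReal.ofReal (Real.exp (lam * ε))
        ≤ ENNReal.ofReal (Real.exp (lam * Loss ω))} := fun ω hω =>
      ENNReal.ofReal_le_ofReal (Real.exp_le_exp.2 (mul_le_mul_of_nonneg_left
        (le_of_lt hω) hlam.le))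
    have h2 := mul_meas_ge_le_lintegral (μ := ν)
      (f := fun ω => ENNReal.ofReal (Real.exp (lam * Loss ω)))
      (Real.measurable_exp.comp (hLoss.const_mul lam)).ennreal_ofReal
      (ENNReal.ofReal (Real.exp (lam * ε)))
    have h3 : ∫⁻ ω, ENNReal.ofReal (Real.exp (lam * Loss ω)) ∂ν
        ≤ ENNReal.ofReal (Real.exp (Fintype.card ι * c)) := by
      simp_rw [← hexp]
      rw [hν, lintegral_pi_prod μ (fun _ z => ENNReal.ofReal (Real.exp (lam * loss z))) fun _ =>
        (Real.measurable_exp.comp (hloss.const_mul lam)).ennreal_ofReal, Finset.prod_const,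
        Finset.card_univ, Real.exp_nat_mul, ENNReal.ofReal_pow (Real.exp_pos _).le]
      exact pow_le_pow_left' hmgf _
    have h4 : ENNReal.ofReal (Real.exp (lam * ε)) * ν {ω | ε < Loss ω}
        ≤ ENNReal.ofReal (Real.exp (lam * ε)) * ENNReal.ofReal δ := by
      refine ((mul_le_mul_right (measure_mono h1) _).trans (h2.trans h3)).trans ?_
      rw [← ENNReal.ofReal_mul (Real.exp_pos _).le]
      refine ENNReal.ofReal_le_ofReal ?_
      calc Real.exp (Fintype.card ι * c)
          = Real.exp (lam * ε) * Real.exp (Fintype.card ι * c - lam * ε) := by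
            rw [← Real.exp_add]; congr 1; ring
        _ ≤ _ := mul_le_mul_of_nonneg_left hδ (Real.exp_pos _).le
    exact (ENNReal.mul_le_mul_iff_right (by simp [Real.exp_pos]) ENNReal.ofReal_ne_top).1 h4
  refine (measure_mono (t := ({ω | (fun i => ω i + w) ∈ F} ∩ {ω | Loss ω ≤ ε})
    ∪ {ω | ε < Loss ω}) fun ω hω => ?_).trans
    ((measure_union_le _ _).trans (add_le_add hgood hbad))
  rcases le_or_gt (Loss ω) ε with h | h
  · exact Or.inl ⟨hω, h⟩
  · exact Or.inr h

/-- Indistinguishability under diagonal shifts of the coordinates in `p` carries over to shifts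
whose size depends on the other coordinates. -/
lemma pi_adaptive_shift_le {ι : Type*} [Fintype ι] {E : Type*} [MeasurableSpace E] [Add E]
    (μ : Measure E) [IsProbabilityMeasure μ] (p : ι → Prop) [DecidablePred p]
    (u : (ι → E) → E) {c δ : ENNReal}
    (hu : ∀ ω, ∀ F : Set ({i // p i} → E), MeasurableSet F →
      (Measure.pi fun _ => μ) {b | (fun i => b i + u ω) ∈ F}
        ≤ c * (Measure.pi fun _ => μ) F + δ)
    (hdep : ∀ ω ω', (∀ i, ¬ p i → ω i = ω' i) → u ω = u ω')
    (G F : Set (ι → E)) (hG : MeasurableSet G) (hF : MeasurableSet F)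
    (hGF : ∀ ω ∈ G, (fun i => if p i then ω i + u ω else ω i) ∈ F) :
    (Measure.pi fun _ => μ) G ≤ c * (Measure.pi fun _ => μ) F + δ := by
  by_cases hne : Nonempty E
  swap
  · have := μ.nonempty_of_neZero
    exact absurd this hne
  let e := MeasurableEquiv.piEquivPiSubtypeProd (fun _ : ι => E) p
  have he := (measurePreserving_piEquivPiSubtypeProd (fun _ : ι => μ) p).symm
  have key : ∀ A : Set (ι → E), MeasurableSet A → (Measure.pi fun _ : ι => μ) A
      = ∫⁻ a, (Measure.pi fun _ : {i // p i} => μ) {b | e.symm (b, a) ∈ A}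
          ∂(Measure.pi fun _ : {i // ¬ p i} => μ) := by
    intro A hA
    rw [← he.measure_preimage hA.nullMeasurableSet, Measure.prod_apply_symm (e.symm.measurable hA)]
    rfl
  rw [key G hG, key F hF, ← lintegral_const_mul]
  · have h1 : ∀ x : ENNReal, ∫⁻ _, x ∂(Measure.pi fun _ : {i // ¬ p i} => μ) = x := by
      intro x; simp
    rw [← h1 δ, ← lintegral_add_right _ measurable_const]
    refine lintegral_mono fun a => ?_
    -- `y` is a dummy filling the coordinates in `p`; by `hdep` the shift does not see it.
    obtain ⟨y⟩ := hne
    have hm : MeasurableSet {b : {i // p i} → E | e.symm (b, a) ∈ F} :=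
      e.symm.measurable.comp measurable_prodMk_right hF
    refine le_trans (measure_mono fun b hb => ?_) (hu (e.symm (fun _ => y, a)) _ hm)
    have h := hGF _ hb
    have hd : u (e.symm (b, a)) = u (e.symm (fun _ => y, a)) := by
      refine hdep _ _ fun i hi => ?_
      simp [e, MeasurableEquiv.piEquivPiSubtypeProd, Equiv.piEquivPiSubtypeProd, hi]
    rw [hd] at h
    show e.symm (_, a) ∈ F
    convert h using 1
    funext i
    by_cases hi : p i <;>
      simp [e, MeasurableEquiv.piEquivPiSubtypeProd, Equiv.piEquivPiSubtypeProd, hi]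
  · exact measurable_measure_prodMk_right (e.symm.measurable hF)

/-! ### The `ℓ_p` norm -/

lemma lpNorm_nonneg {d : ℕ} {p : ENNReal} (hp : 1 ≤ p) (x : Vec d) : 0 ≤ lpNorm p x := by
  have : Fact (1 ≤ p) := ⟨hp⟩
  exact norm_nonneg (WithLp.toLp p (fun i => x i) : PiLp p (fun _ : Fin d => ℝ))

lemma lpNorm_zero {d : ℕ} {p : ENNReal} (hp : 1 ≤ p) : lpNorm p (0 : Vec d) = 0 := by
  have : Fact (1 ≤ p) := ⟨hp⟩
  exact norm_zero (E := PiLp p (fun _ : Fin d => ℝ))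

lemma lpNorm_add_le {d : ℕ} {p : ENNReal} (hp : 1 ≤ p) (x y : Vec d) :
    lpNorm p (x + y) ≤ lpNorm p x + lpNorm p y := by
  have : Fact (1 ≤ p) := ⟨hp⟩
  exact norm_add_le (WithLp.toLp p (fun i => x i) : PiLp p (fun _ : Fin d => ℝ))
    (WithLp.toLp p (fun i => y i))

lemma lpNorm_sub_le {d : ℕ} {p : ENNReal} (hp : 1 ≤ p) (x y : Vec d) :
    lpNorm p (x - y) ≤ lpNorm p x + lpNorm p y := by
  have : Fact (1 ≤ p) := ⟨hp⟩
  exact norm_sub_le (WithLp.toLp p (fun i => x i) : PiLp p (fun _ : Fin d => ℝ))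
    (WithLp.toLp p (fun i => y i))

lemma lpNorm_smul {d : ℕ} {p : ENNReal} (hp : 1 ≤ p) (a : ℝ) (x : Vec d) :
    lpNorm p (a • x) = |a| * lpNorm p x := by
  have : Fact (1 ≤ p) := ⟨hp⟩
  exact norm_smul a (WithLp.toLp p (fun i => x i) : PiLp p (fun _ : Fin d => ℝ))

lemma continuous_lpNorm {d : ℕ} {p : ENNReal} (hp : 1 ≤ p) :
    Continuous (lpNorm p : Vec d → ℝ) := by
  have : Fact (1 ≤ p) := ⟨hp⟩
  exact continuous_norm.comp ((PiLp.continuous_toLp p (fun _ : Fin d => ℝ)).comp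
    (PiLp.continuous_ofLp 2 (fun _ : Fin d => ℝ)))

lemma abs_apply_le_lpNorm {d : ℕ} {p : ENNReal} (hp : 1 ≤ p) (x : Vec d) (i : Fin d) :
    |x i| ≤ lpNorm p x := by
  have : Fact (1 ≤ p) := ⟨hp⟩
  exact PiLp.norm_apply_le (WithLp.toLp p (fun i => x i) : PiLp p (fun _ : Fin d => ℝ)) i

lemma norm_sq_le_lpNorm_sq {d : ℕ} {p : ENNReal} (hp : 1 ≤ p) (x : Vec d) :
    ‖x‖ ^ 2 ≤ d * lpNorm p x ^ 2 := by
  rw [EuclideanSpace.norm_sq_eq]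
  refine (Finset.sum_le_card_nsmul Finset.univ _ (lpNorm p x ^ 2) fun i _ => ?_).trans (by simp)
  rw [Real.norm_eq_abs]
  exact pow_le_pow_left₀ (abs_nonneg _) (abs_apply_le_lpNorm hp x i) 2

lemma eq_zero_of_lpNorm_le_zero {d : ℕ} {p : ENNReal} (hp : 1 ≤ p) {x : Vec d}
    (hx : lpNorm p x ≤ 0) : x = 0 := by
  ext i
  simpa using (abs_apply_le_lpNorm hp x i).trans hx

/-! ### The generalized Gaussian -/

lemma IsSmoothNorm.continuous {d : ℕ} {κ : ℝ} {N : Seminorm ℝ (Vec d)} (h : IsSmoothNorm κ N) :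
    Continuous N := by
  have h1 : (N : Vec d → ℝ) = fun x => Real.sqrt (N x ^ 2) := by
    funext x
    rw [Real.sqrt_sq (apply_nonneg N x)]
  rw [h1]
  exact Real.continuous_sqrt.comp h.1.continuous

/-- Smoothness at `z` along the two directions `w` and `-lam • w`. -/
lemma IsSmoothNorm.sq_sub_smul_le {d : ℕ} {κ : ℝ} {N : Seminorm ℝ (Vec d)}
    (h : IsSmoothNorm κ N) (z w : Vec d) {lam : ℝ} (hlam : 0 ≤ lam) :
    N (z - lam • w) ^ 2 + lam * N (z + w) ^ 2
      ≤ (1 + lam) * N z ^ 2 + lam * (lam + 1) * (κ * N w ^ 2) := by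
  -- The derivative terms of `h1` and `h2` cancel, since the directions are weighted to sum to zero.
  have h1 := h.2 z (-(lam • w))
  have h2 := mul_le_mul_of_nonneg_left (h.2 z w) hlam
  rw [← sub_eq_add_neg, map_neg_eq_map N, map_smul_eq_mul N, Real.norm_eq_abs, mul_pow, sq_abs,
    ContinuousLinearMap.map_neg, ContinuousLinearMap.map_smul, smul_eq_mul] at h1
  nlinarith

section Gaussian

variable {d : ℕ} {N : Seminorm ℝ (Vec d)} {v : ℝ}

lemma measurable_gaussianDensity (hN : Continuous N) (m : Vec d) (v : ℝ) :
    Measurable fun z => ENNReal.ofReal (Real.exp (-(N (z - m) ^ 2) / (2 * v))) := by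
  have : Continuous fun z => Real.exp (-(N (z - m) ^ 2) / (2 * v)) := by fun_prop
  exact this.measurable.ennreal_ofReal

lemma gaussianWeight_univ_ne_top (hv : 0 < v) {a : ℝ} (ha : 0 < a)
    (hc : ∀ z, a * ‖z‖ ^ 2 ≤ N z ^ 2) : gaussianWeight N 0 v Set.univ ≠ ⊤ := by
  rw [gaussianWeight, withDensity_apply _ MeasurableSet.univ, Measure.restrict_univ]
  have hb : 0 < a / (2 * v) := by positivity
  have hint : Integrable (fun z : Vec d => Real.exp (-(a / (2 * v)) * ‖z‖ ^ 2)) := by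
    -- A non-integrable function has Bochner integral `0`, whereas the Gaussian formula gives a
    -- positive value.
    by_contra hcon
    have h1 := GaussianFourier.integral_rexp_neg_mul_sq_norm (V := Vec d) hb
    rw [integral_undef hcon] at h1
    have : 0 < (Real.pi / (a / (2 * v))) ^ ((Module.finrank ℝ (Vec d) : ℝ) / 2) := by positivity
    linarith
  refine ne_top_of_le_ne_top hint.lintegral_lt_top.ne (lintegral_mono fun z => ?_)
  refine ENNReal.ofReal_le_ofReal (Real.exp_le_exp.2 ?_)
  rw [sub_zero, neg_mul, neg_div, neg_le_neg_iff, div_mul_eq_mul_div]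
  exact div_le_div_of_nonneg_right (hc z) (by positivity)

lemma gaussianWeight_univ_ne_zero (hN : Continuous N) : gaussianWeight N 0 v Set.univ ≠ 0 := by
  rw [gaussianWeight, withDensity_apply _ MeasurableSet.univ, Measure.restrict_univ]
  intro h
  rw [lintegral_eq_zero_iff (measurable_gaussianDensity hN 0 v)] at h
  have h1 : ∀ᵐ z : Vec d, False := by
    filter_upwards [h] with z hz
    simp at hz
    exact absurd hz (Real.exp_pos _).not_ge
  rw [Filter.eventually_false_iff_eq_bot, ae_eq_bot] at h1
  exact NeZero.ne _ h1

lemma isProbabilityMeasure_generalizedGaussian (hN : Continuous N) (hv : 0 ≤ v) {a : ℝ}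
    (ha : 0 < a) (hc : ∀ z, a * ‖z‖ ^ 2 ≤ N z ^ 2) :
    IsProbabilityMeasure (generalizedGaussian N 0 v) := by
  rw [generalizedGaussian]
  split_ifs with h
  · infer_instance
  · refine ⟨?_⟩
    rw [Measure.smul_apply, smul_eq_mul]
    exact ENNReal.inv_mul_cancel (gaussianWeight_univ_ne_zero hN)
      (gaussianWeight_univ_ne_top (lt_of_le_of_ne hv (Ne.symm h)) ha hc)

/-- The tilt turns the weight at `z` into the original weight at `z + w`; translation invariance of
Lebesgue measure does the rest. -/
lemma map_generalizedGaussian_withDensity (hN : Continuous N) (hv : 0 < v) (w : Vec d) :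
    ((generalizedGaussian N 0 v).withDensity fun z =>
      ENNReal.ofReal (Real.exp (-((N (z + w) ^ 2 - N z ^ 2) / (2 * v))))).map (fun z => z + w)
      = generalizedGaussian N 0 v := by
  have hm : Measurable fun z : Vec d =>
      ENNReal.ofReal (Real.exp (-((N (z + w) ^ 2 - N z ^ 2) / (2 * v)))) := by
    have : Continuous fun z => Real.exp (-((N (z + w) ^ 2 - N z ^ 2) / (2 * v))) := by fun_prop
    exact this.measurable.ennreal_ofReal
  rw [generalizedGaussian, if_neg hv.ne', withDensity_smul_measure, Measure.map_smul,
    gaussianWeight, ← withDensity_mul _ (measurable_gaussianDensity hN 0 v) hm]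
  congr 1
  ext s hs
  rw [Measure.map_apply (measurable_add_const w) hs,
    withDensity_apply _ (measurable_add_const w hs), withDensity_apply _ hs,
    ← lintegral_indicator hs, ← lintegral_indicator (measurable_add_const w hs),
    ← lintegral_add_right_eq_self (s.indicator _) w]
  refine lintegral_congr fun z => ?_
  by_cases hz : z + w ∈ s
  · rw [Set.indicator_of_mem (show z ∈ (fun z => z + w) ⁻¹' s from hz), Set.indicator_of_mem hz,
      Pi.mul_apply, ← ENNReal.ofReal_mul (Real.exp_pos _).le, ← Real.exp_add]
    congr 2
    rw [sub_zero, sub_zero]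
    ring
  · rw [Set.indicator_of_notMem (show z ∉ (fun z => z + w) ⁻¹' s from hz),
      Set.indicator_of_notMem hz]

/-- A substitute for completing the square: by `sq_sub_smul_le` the tilted weight is at most a
constant times the weight translated by `lam • w`, which has the same total mass. -/
lemma lintegral_exp_loss_le {κ : ℝ} (hs : IsSmoothNorm κ N) (hv : 0 < v) (w : Vec d) {lam B : ℝ}
    (hlam : 0 ≤ lam) (hB : κ * N w ^ 2 ≤ B)
    [IsProbabilityMeasure (generalizedGaussian N 0 v)] :
    ∫⁻ z, ENNReal.ofReal (Real.exp (lam * ((N (z + w) ^ 2 - N z ^ 2) / (2 * v))))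
        ∂(generalizedGaussian N 0 v)
      ≤ ENNReal.ofReal (Real.exp (lam * (lam + 1) * (B / (2 * v)))) := by
  have hN := hs.continuous
  have hm : Measurable fun z : Vec d =>
      ENNReal.ofReal (Real.exp (lam * ((N (z + w) ^ 2 - N z ^ 2) / (2 * v)))) := by
    have : Continuous fun z => Real.exp (lam * ((N (z + w) ^ 2 - N z ^ 2) / (2 * v))) := by
      fun_prop
    exact this.measurable.ennreal_ofReal
  have h1 : (generalizedGaussian N 0 v) Set.univ = 1 := measure_univ
  rw [generalizedGaussian, if_neg hv.ne', Measure.smul_apply, smul_eq_mul] at h1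
  rw [generalizedGaussian, if_neg hv.ne', lintegral_smul_measure, smul_eq_mul]
  refine le_trans (mul_le_mul_right (c := ENNReal.ofReal (Real.exp (lam * (lam + 1) * (B / (2 * v))))
    * gaussianWeight N 0 v Set.univ) ?_ _) (le_of_eq ?_)
  · rw [gaussianWeight, lintegral_withDensity_eq_lintegral_mul _
      (measurable_gaussianDensity hN 0 v) hm, withDensity_apply _ MeasurableSet.univ,
      Measure.restrict_univ,
      ← lintegral_sub_right_eq_self (fun z => ENNReal.ofReal (Real.exp _)) (lam • w),
      ← lintegral_const_mul]
    · refine lintegral_mono fun z => ?_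
      rw [Pi.mul_apply, ← ENNReal.ofReal_mul (Real.exp_pos _).le,
        ← ENNReal.ofReal_mul (Real.exp_pos _).le, ← Real.exp_add, ← Real.exp_add]
      refine ENNReal.ofReal_le_ofReal (Real.exp_le_exp.2 ?_)
      have h2 := hs.sq_sub_smul_le z w hlam
      have h3 := mul_le_mul_of_nonneg_left hB (by positivity : 0 ≤ lam * (lam + 1))
      rw [sub_zero, sub_zero, ← sub_nonneg]
      have h4 : lam * (lam + 1) * (B / (2 * v)) + -N (z - lam • w) ^ 2 / (2 * v)
          - (-N z ^ 2 / (2 * v) + lam * ((N (z + w) ^ 2 - N z ^ 2) / (2 * v)))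
          = (lam * (lam + 1) * B + (1 + lam) * N z ^ 2 - N (z - lam • w) ^ 2
            - lam * N (z + w) ^ 2) / (2 * v) := by
        ring
      rw [h4]
      exact div_nonneg (by linarith) (by positivity)
    · exact (measurable_gaussianDensity hN 0 v).comp (measurable_sub_const (lam • w))
  · rw [mul_left_comm, h1, mul_one]

end Gaussian

/-! ### The tree -/

/-- The noise draw `(s, h)` (time `s + 1`, height `h`) goes to the node of height `h` on the path
of time `i + 1`. -/
def IsPathNoise {n : ℕ} (i : ℕ) (c : Fin n × Fin (height n + 1)) : Prop :=
  (c.1 : ℕ) + 1 = (i / 2 ^ (c.2 : ℕ) + 1) * 2 ^ (c.2 : ℕ)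

instance {n : ℕ} (i : ℕ) : DecidablePred (IsPathNoise (n := n) i) := fun _ => Nat.decEq _ _

/-- A node above a leaf cannot end before that leaf. Hence no shifted draw influences the increment
at time `i + 1`. -/
lemma IsPathNoise.le {n i : ℕ} {c : Fin n × Fin (height n + 1)} (h : IsPathNoise i c) :
    i ≤ c.1 := by
  have h1 := Nat.lt_div_mul_add (a := i) (b := 2 ^ (c.2 : ℕ)) (by positivity)
  rw [IsPathNoise, add_mul, one_mul] at h
  omega

lemma card_isPathNoise_le {n : ℕ} (i : ℕ) :
    Fintype.card {c : Fin n × Fin (height n + 1) // IsPathNoise i c} ≤ height n + 1 := by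
  have : Function.Injective
      fun c : {c : Fin n × Fin (height n + 1) // IsPathNoise i c} => c.1.2 := by
    rintro ⟨⟨s, h⟩, hc⟩ ⟨⟨s', h'⟩, hc'⟩ (rfl : h = h')
    simp only [IsPathNoise] at hc hc'
    have : s = s' := Fin.ext (by omega)
    subst this
    rfl
  simpa using Fintype.card_le_of_injective _ this

/-- The path of time `t + 1` is a chain of right children below height `h` exactly if `t + 1` is
the last time of its node of height `h`. -/
lemma upToFirstLeft_iff (t h : ℕ) :
    UpToFirstLeft (t + 1) h ↔ t + 1 = (t / 2 ^ h + 1) * 2 ^ h := by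
  simp only [UpToFirstLeft, IsLeftIndex, pathIndex, Nat.add_sub_cancel]
  induction h with
  | zero => simp
  | succ h ih =>
    have hsplit : (∀ h' < h + 1, ¬ Even (t / 2 ^ h')) ↔
        (∀ h' < h, ¬ Even (t / 2 ^ h')) ∧ ¬ Even (t / 2 ^ h) :=
      ⟨fun H => ⟨fun h' hh => H h' (by omega), H h (by omega)⟩, fun H h' hh => by
        rcases Nat.lt_succ_iff_lt_or_eq.1 hh with h1 | rfl
        exacts [H.1 h' h1, H.2]⟩
    rw [hsplit, ih, pow_succ, ← Nat.div_div_eq_div_mul, Nat.not_even_iff_odd]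
    set q := t / 2 ^ h with hq
    set P := 2 ^ h with hP
    have hPpos : 0 < P := by positivity
    have hlt : t < (q + 1) * P := by
      rw [add_mul, one_mul]; exact Nat.lt_div_mul_add hPpos
    constructor
    · rintro ⟨h1, m, hm⟩
      have h2 : q / 2 = m := by omega
      rw [h2, h1, hm]
      ring
    -- The parent's interval ends no earlier than the child's, and `t + 1` is at most the child's
    -- end; so both ends coincide and the child is a right one.
    · intro h1
      have h2 : q + 1 ≤ (q / 2 + 1) * 2 := by omega
      have h3 : (q + 1) * P ≤ (q / 2 + 1) * (P * 2) := by
        calc (q + 1) * P ≤ ((q / 2 + 1) * 2) * P := Nat.mul_le_mul_right _ h2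
          _ = _ := by ring
      have h4 : t + 1 = (q + 1) * P := by omega
      refine ⟨h4, ?_⟩
      have h5 : (q + 1) * P = ((q / 2 + 1) * 2) * P := by
        rw [← h4, h1]; ring
      have h6 := Nat.eq_of_mul_eq_mul_right hPpos h5
      exact ⟨q / 2, by omega⟩

/-- The private partial sum at time `t` only reads nodes all of whose leaves have times `≤ t`. -/
lemma noisyPartialSum_congr {V : Type*} [AddCommMonoid V] (H t : ℕ) {A B : ℕ → ℕ → V}
    (hAB : ∀ h j, (j + 1) * 2 ^ h ≤ t → A h j = B h j) :
    noisyPartialSum H t A = noisyPartialSum H t B := by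
  refine Finset.sum_congr rfl fun h _ => ?_
  split_ifs with h1 h2
  -- With bit `h` set, `t / 2 ^ h` is odd while `(t - 1) / 2 ^ h` is even, so the quotient has just
  -- increased: the node ends by time `t`.
  · apply hAB
    simp only [IsLeftIndex, pathIndex] at h2 ⊢
    rw [Nat.testBit_eq_decide_div_mod_eq] at h1
    have h1 : t / 2 ^ h % 2 = 1 := by simpa using h1
    have h3 : (t - 1) / 2 ^ h ≤ t / 2 ^ h := Nat.div_le_div_right (by omega)
    have h4 := Nat.even_iff.1 h2
    rw [← Nat.le_div_iff_mul_le (by positivity)]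
    omega
  -- The left sibling ends where the path node begins, hence before `t`.
  · apply hAB
    simp only [IsLeftIndex, pathIndex] at h2 ⊢
    have h4 := Nat.not_even_iff.1 h2
    have h3 := Nat.div_mul_le_self (t - 1) (2 ^ h)
    have h5 : 1 ≤ (t - 1) / 2 ^ h := Nat.one_le_iff_ne_zero.2 fun h0 => by simp [h0] at h4
    rw [Nat.sub_add_cancel h5]
    omega
  · rfl

/-! ### Coupling of the runs on neighbouring datasets -/

section Run

variable {d n : ℕ} {X : Type*} (gradf : Vec d → X → Vec d) (lmo : Vec d → Vec d)

/-- The first `t` iterations only use the noise of the first `t` times. -/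
lemma run_congr (x : Fin n → X) (ω ω' : Noise d n) (t : ℕ) (ht : t ≤ n)
    (h : ∀ c : Fin n × Fin (height n + 1), (c.1 : ℕ) < t → ω c = ω' c) :
    run gradf lmo x ω t ht = run gradf lmo x ω' t ht := by
  induction t with
  | zero => rfl
  | succ t ih =>
    simp only [run]
    rw [ih _ fun c hc => h c (by omega)]
    congr 1
    funext k
    exact h _ (Nat.lt_succ_self t)

/-- The increment which the sample `z` would give at time `i + 1` of the run on `x`. -/
noncomputable def incrementAt (x : Fin n → X) (ω : Noise d n) (i : Fin n) (z : X) : Vec d :=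
  gradIncrement gradf (i + 1) z (run gradf lmo x ω i i.2.le).prev (run gradf lmo x ω i i.2.le).cur

/-- The noise of a run on a dataset that differs in entry `i` after shifting the draws of the path
nodes by `u`. -/
def shiftNoise (i : Fin n) (u : Vec d) (ω : Noise d n) : Noise d n :=
  fun c => if IsPathNoise (i : ℕ) c then ω c + u else ω c

/-- The invariant tracks the nodes above leaf `i` that are still open: they lack `u`, and the
shifted draw restores it when the node closes. Since only closed nodes are read, the iterates never
differ. -/
lemma run_shiftNoise (x x' : Fin n → X) (i : Fin n) (hx : ∀ j, j ≠ i → x j = x' j)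
    (ω : Noise d n) (u : Vec d)
    (hu : u = incrementAt gradf lmo x ω i (x i) - incrementAt gradf lmo x ω i (x' i))
    (t : ℕ) (ht : t ≤ n) :
    (run gradf lmo x' (shiftNoise i u ω) t ht).prev = (run gradf lmo x ω t ht).prev ∧
    (run gradf lmo x' (shiftNoise i u ω) t ht).cur = (run gradf lmo x ω t ht).cur ∧
    ∀ h j, (run gradf lmo x' (shiftNoise i u ω) t ht).tree h j =
      (run gradf lmo x ω t ht).tree h j +
        if h < height n + 1 ∧ (i : ℕ) < t ∧ j = i / 2 ^ h ∧ t < (j + 1) * 2 ^ h then -u else 0 := by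
  induction t with
  | zero => simp [run, State.init]
  | succ t ih =>
    obtain ⟨hp, hc, htree⟩ := ih (by omega)
    set S := run gradf lmo x ω t (by omega) with hS
    set S' := run gradf lmo x' (shiftNoise i u ω) t (by omega) with hS'
    have hg : gradIncrement gradf (t + 1) (x' ⟨t, ht⟩) S.prev S.cur
        = gradIncrement gradf (t + 1) (x ⟨t, ht⟩) S.prev S.cur + if t = i then -u else 0 := by
      split_ifs with hti
      · subst hti
        rw [hu]
        simp only [incrementAt, Fin.eta]
        rw [← hS]
        abel
      · rw [add_zero, hx ⟨t, ht⟩ fun h => hti (by rw [← h])]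
    have hA : ∀ h j, treeUpdate (height n) (t + 1)
          (gradIncrement gradf (t + 1) (x' ⟨t, ht⟩) S'.prev S'.cur)
          (fun h => shiftNoise i u ω (⟨t, ht⟩, h)) S'.tree h j
        = treeUpdate (height n) (t + 1) (gradIncrement gradf (t + 1) (x ⟨t, ht⟩) S.prev S.cur)
            (fun h => ω (⟨t, ht⟩, h)) S.tree h j +
          if h < height n + 1 ∧ (i : ℕ) < t + 1 ∧ j = i / 2 ^ h ∧ t + 1 < (j + 1) * 2 ^ h
            then -u else 0 := by
      intro h j
      have hP : 0 < 2 ^ h := by positivity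
      have hlow := Nat.div_mul_le_self (i : ℕ) (2 ^ h)
      have hup := Nat.lt_div_mul_add (a := (i : ℕ)) hP
      have hlow' := Nat.div_mul_le_self t (2 ^ h)
      have hup' := Nat.lt_div_mul_add (a := t) hP
      have hpath : ∀ k : Fin (height n + 1), IsPathNoise (i : ℕ) ((⟨t, ht⟩ : Fin n), k)
          ↔ t + 1 = (i / 2 ^ (k : ℕ) + 1) * 2 ^ (k : ℕ) := fun _ => Iff.rfl
      rw [hp, hc, hg]
      simp only [treeUpdate, htree, upToFirstLeft_iff, pathIndex, Nat.add_sub_cancel, shiftNoise,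
        hpath]
      by_cases hh : h < height n + 1
      swap
      · simp [hh]
      simp only [hh, dif_pos, true_and]
      by_cases hj : j = t / 2 ^ h
      swap
      · rw [if_neg hj, if_neg hj]
        have hno : ∀ T, t ≤ T → ¬ ((i : ℕ) ≤ t ∧ j = i / 2 ^ h ∧ T < (j + 1) * 2 ^ h) := by
          rintro T hT ⟨h1, h2, h3⟩
          refine hj (Nat.le_antisymm ?_ ?_)
          · rw [h2]; exact Nat.div_le_div_right h1
          · exact Nat.le_of_lt_add_one ((Nat.div_lt_iff_lt_mul hP).2 (by omega))
        rw [if_neg fun H => hno t le_rfl ⟨H.1.le, H.2⟩,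
          if_neg fun H => hno (t + 1) (by omega) ⟨by omega, H.2⟩]
      · subst hj
        rw [if_pos rfl, if_pos rfl]
        by_cases hij : t / 2 ^ h = i / 2 ^ h
        · rw [← hij, add_mul, one_mul]
          simp only [true_and]
          -- If the node closes now, its noise brings `+u`, cancelling a `-u` that is either already
          -- stored (`i < t`) or added in this very step (`t = i`).
          by_cases hlast : t + 1 = t / 2 ^ h * 2 ^ h + 2 ^ h
          · rw [if_pos hlast, if_pos hlast, if_neg (show ¬ ((i : ℕ) < t + 1 ∧
              t + 1 < t / 2 ^ h * 2 ^ h + 2 ^ h) by omega)]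
            rw [← hij] at hup
            rcases Nat.lt_or_ge i t with hit | hit
            · rw [if_pos (show (i : ℕ) < t ∧ t < t / 2 ^ h * 2 ^ h + 2 ^ h by omega),
                if_neg (by omega), if_pos hlast]
              abel
            · rw [if_neg (show ¬ ((i : ℕ) < t ∧ t < t / 2 ^ h * 2 ^ h + 2 ^ h) by omega),
                if_pos (by omega), if_pos hlast]
              abel
          · rw [if_neg hlast, if_neg hlast]
            rcases lt_trichotomy t i with hit | hit | hit
            · rw [if_neg (by omega), if_neg (by omega), if_neg (by omega)]
              abel
            · rw [if_neg (by omega), if_pos hit, if_pos (by omega)]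
              abel
            · rw [if_pos (by omega), if_neg (by omega), if_pos (by omega)]
              abel
        · have hti : t ≠ i := fun h1 => hij (by rw [h1])
          have hnl : ¬ (t + 1 = (i / 2 ^ h + 1) * 2 ^ h) := by
            intro h1
            refine hij (Nat.le_antisymm ?_ ?_)
            · exact Nat.le_of_lt_add_one ((Nat.div_lt_iff_lt_mul hP).2 (by omega))
            · rw [Nat.le_div_iff_mul_le hP]
              rw [add_mul, one_mul] at h1
              omega
          simp only [hij, false_and, and_false, if_false, hti, hnl, add_zero]
    -- The sum reads only closed nodes, where the correction in `hA` vanishes.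
    have hsum := noisyPartialSum_congr (height n) (t + 1)
      (A := treeUpdate (height n) (t + 1)
          (gradIncrement gradf (t + 1) (x' ⟨t, ht⟩) S'.prev S'.cur)
          (fun h => shiftNoise i u ω (⟨t, ht⟩, h)) S'.tree)
      (B := treeUpdate (height n) (t + 1) (gradIncrement gradf (t + 1) (x ⟨t, ht⟩) S.prev S.cur)
            (fun h => ω (⟨t, ht⟩, h)) S.tree) fun h j hj => by
        rw [hA, if_neg (by omega), add_zero]
    simp only [run, State.step]
    refine ⟨hc, ?_, hA⟩
    rw [← hS, ← hS', hsum, hc]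

lemma iterates_shiftNoise (x x' : Fin n → X) (i : Fin n) (hx : ∀ j, j ≠ i → x j = x' j)
    (ω : Noise d n) (u : Vec d)
    (hu : u = incrementAt gradf lmo x ω i (x i) - incrementAt gradf lmo x ω i (x' i)) :
    iterates gradf lmo x' (shiftNoise i u ω) = iterates gradf lmo x ω :=
  funext fun t => (run_shiftNoise gradf lmo x x' i hx ω u hu t _).2.1

/-- All iterates stay in `C`, and consecutive ones are close. -/
lemma run_mem {C : Set (Vec d)} (hconv : Convex ℝ C) (h0 : (0 : Vec d) ∈ C)
    (hlmo : ∀ g, lmo g ∈ C) (x : Fin n → X) (ω : Noise d n) (t : ℕ) (ht : t ≤ n) :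
    (run gradf lmo x ω t ht).prev ∈ C ∧ (run gradf lmo x ω t ht).cur ∈ C ∧
      ∃ v ∈ C, ((t : ℝ) + 1) • ((run gradf lmo x ω t ht).cur - (run gradf lmo x ω t ht).prev)
        = v - (run gradf lmo x ω t ht).prev := by
  induction t with
  | zero => exact ⟨h0, h0, 0, h0, by simp [run, State.init]⟩
  | succ t ih =>
    obtain ⟨-, hc, -⟩ := ih (by omega)
    simp only [run, State.step]
    set w := lmo _
    have hw : w ∈ C := hlmo _
    refine ⟨hc, ?_, w, hw, ?_⟩
    · refine hconv.add_smul_sub_mem hc hw ⟨by positivity, ?_⟩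
      rw [div_le_one (by positivity)]
      push_cast
      linarith [(Nat.cast_nonneg t : (0 : ℝ) ≤ t)]
    · rw [add_sub_cancel_left, smul_smul]
      have : (((t + 1 : ℕ) : ℝ) + 1) * (1 / (1 + ((t + 1 : ℕ) : ℝ))) = 1 := by
        push_cast
        field_simp
        ring
      rw [this, one_smul]

/-- The gradient is controlled only on `C`, so its composition with an iterate is measurable because
the iterates stay in `C`. -/
lemma measurable_run {C : Set (Vec d)} (hconv : Convex ℝ C) (h0 : (0 : Vec d) ∈ C)
    (hmem : ∀ g, lmo g ∈ C) (hlmo : Measurable lmo)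
    (hgrad : ∀ x, ContinuousOn (fun θ => gradf θ x) C) (x : Fin n → X) (t : ℕ) (ht : t ≤ n) :
    Measurable (fun ω : Noise d n => (run gradf lmo x ω t ht).prev) ∧
    Measurable (fun ω : Noise d n => (run gradf lmo x ω t ht).cur) ∧
    ∀ h j, Measurable (fun ω : Noise d n => (run gradf lmo x ω t ht).tree h j) := by
  induction t with
  | zero => exact ⟨measurable_const, measurable_const, fun _ _ => measurable_const⟩
  | succ t ih =>
    obtain ⟨hp, hc, htree⟩ := ih (by omega)
    have hcomp : ∀ (θ : Noise d n → Vec d), Measurable θ → (∀ ω, θ ω ∈ C) → ∀ z,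
        Measurable fun ω => gradf (θ ω) z := fun θ hθ hC z =>
      (continuousOn_iff_continuous_domRestrict.1 (hgrad z)).measurable.comp (hθ.subtype_mk (h := hC))
    have hg : Measurable fun ω : Noise d n => gradIncrement gradf (t + 1) (x ⟨t, ht⟩)
        (run gradf lmo x ω t (by omega)).prev (run gradf lmo x ω t (by omega)).cur := by
      unfold gradIncrement
      have h1 := hcomp _ hc (fun ω => (run_mem gradf lmo hconv h0 hmem x ω t _).2.1) (x ⟨t, ht⟩)
      have h2 := hcomp _ hp (fun ω => (run_mem gradf lmo hconv h0 hmem x ω t _).1) (x ⟨t, ht⟩)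
      exact (h1.const_smul (((t + 1 : ℕ) : ℝ) + 1)).sub (h2.const_smul ((t + 1 : ℕ) : ℝ))
    have hA : ∀ h j, Measurable fun ω : Noise d n =>
        treeUpdate (height n) (t + 1) (gradIncrement gradf (t + 1) (x ⟨t, ht⟩)
          (run gradf lmo x ω t (by omega)).prev (run gradf lmo x ω t (by omega)).cur)
          (fun h => ω (⟨t, ht⟩, h)) (run gradf lmo x ω t (by omega)).tree h j := by
      intro h j
      unfold treeUpdate
      split_ifs
      · exact ((htree h j).add hg).add (measurable_pi_apply _)
      · exact ((htree h j).add hg).add measurable_const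
      · exact htree h j
      · exact htree h j
    have hsum : Measurable fun ω : Noise d n => noisyPartialSum (height n) (t + 1)
        (treeUpdate (height n) (t + 1) (gradIncrement gradf (t + 1) (x ⟨t, ht⟩)
          (run gradf lmo x ω t (by omega)).prev (run gradf lmo x ω t (by omega)).cur)
          (fun h => ω (⟨t, ht⟩, h)) (run gradf lmo x ω t (by omega)).tree) := by
      unfold noisyPartialSum
      refine Finset.measurable_sum _ fun h _ => ?_
      split_ifs
      · exact hA _ _
      · exact hA _ _
      · exact measurable_const
    simp only [run, State.step]
    have hv := hlmo.comp (hsum.const_smul (1 / (((t + 1 : ℕ) : ℝ) + 1)))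
    exact ⟨hc, hc.add ((hv.sub hc).const_smul (1 / (1 + ((t + 1 : ℕ) : ℝ)))), hA⟩

lemma measurable_iterates {C : Set (Vec d)} (hconv : Convex ℝ C) (h0 : (0 : Vec d) ∈ C)
    (hmem : ∀ g, lmo g ∈ C) (hlmo : Measurable lmo)
    (hgrad : ∀ x, ContinuousOn (fun θ => gradf θ x) C) (x : Fin n → X) :
    Measurable (iterates gradf lmo x) :=
  measurable_pi_lambda _ fun t =>
    (measurable_run gradf lmo hconv h0 hmem hlmo hgrad x t _).2.1

end Run

/-! ### Privacy of DP-TOFW -/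

lemma continuousOn_of_lpNorm_sub_le {d : ℕ} {p q : ENNReal} (hp : 1 ≤ p) (hq : 1 ≤ q)
    {C : Set (Vec d)} {β : ℝ} {G : Vec d → Vec d}
    (hG : ∀ θ₁ ∈ C, ∀ θ₂ ∈ C, lpNorm q (G θ₁ - G θ₂) ≤ β * lpNorm p (θ₁ - θ₂)) :
    ContinuousOn G C := by
  intro θ hθ
  rw [ContinuousWithinAt, tendsto_iff_norm_sub_tendsto_zero]
  have hlim : Filter.Tendsto (fun y => Real.sqrt (d * (β * lpNorm p (y - θ)) ^ 2))
      (nhdsWithin θ C) (nhds 0) := by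
    have hcont : Continuous fun y => Real.sqrt (d * (β * lpNorm p (y - θ)) ^ 2) := by
      have := continuous_lpNorm (d := d) hp
      fun_prop
    have h := hcont.continuousWithinAt (s := C) (x := θ)
    simpa [ContinuousWithinAt, lpNorm_zero hp] using h
  refine squeeze_zero' (Filter.Eventually.of_forall fun _ => norm_nonneg _) ?_ hlim
  filter_upwards [self_mem_nhdsWithin] with y hy
  refine Real.le_sqrt_of_sq_le ((norm_sq_le_lpNorm_sq hq _).trans ?_)
  exact mul_le_mul_of_nonneg_left (pow_le_pow_left₀ (lpNorm_nonneg hq _) (hG y hy θ hθ) 2)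
    (Nat.cast_nonneg d)

/-- The increment is `i + 1` times a gradient difference plus one gradient. The factor is absorbed
by the step size, because `(i + 1) • (θ - θ')` is a difference of two points of `C`. -/
lemma lpNorm_incrementAt_le {d n : ℕ} {X : Type*} {p q : ENNReal} (hp : 1 ≤ p) (hq : 1 ≤ q)
    {C : Set (Vec d)} (hconv : Convex ℝ C) (h0 : (0 : Vec d) ∈ C) {D β L : ℝ} (hβ : 0 ≤ β)
    (hD : ∀ θ₁ ∈ C, ∀ θ₂ ∈ C, lpNorm p (θ₁ - θ₂) ≤ D)
    (gradf : Vec d → X → Vec d) (lmo : Vec d → Vec d) (hlmo : ∀ g, lmo g ∈ C)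
    (hsmooth : ∀ x, ∀ θ₁ ∈ C, ∀ θ₂ ∈ C,
      lpNorm q (gradf θ₁ x - gradf θ₂ x) ≤ β * lpNorm p (θ₁ - θ₂))
    (hlip : ∀ x, ∀ θ ∈ C, lpNorm q (gradf θ x) ≤ L)
    (x : Fin n → X) (ω : Noise d n) (i : Fin n) (z : X) :
    lpNorm q (incrementAt gradf lmo x ω i z) ≤ β * D + L := by
  obtain ⟨hprev, hcur, v, hv, hstep⟩ := run_mem gradf lmo hconv h0 hlmo x ω i i.2.le
  rw [incrementAt]
  set θ' := (run gradf lmo x ω i i.2.le).prev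
  set θ := (run gradf lmo x ω i i.2.le).cur
  have hi : (0 : ℝ) ≤ (i : ℝ) + 1 := by positivity
  have h1 : gradIncrement gradf (i + 1) z θ' θ
      = ((i : ℝ) + 1) • (gradf θ z - gradf θ' z) + gradf θ z := by
    rw [gradIncrement]
    push_cast
    module
  rw [h1]
  refine (lpNorm_add_le hq _ _).trans (add_le_add ?_ (hlip z θ hcur))
  rw [lpNorm_smul hq, abs_of_nonneg hi]
  calc ((i : ℝ) + 1) * lpNorm q (gradf θ z - gradf θ' z)
      ≤ ((i : ℝ) + 1) * (β * lpNorm p (θ - θ')) :=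
        mul_le_mul_of_nonneg_left (hsmooth z θ hcur θ' hprev) hi
    _ = β * lpNorm p (v - θ') := by
        rw [← hstep, lpNorm_smul hp, abs_of_nonneg hi]; ring
    _ ≤ β * D := mul_le_mul_of_nonneg_left (hD v hv θ' hprev) hβ

lemma IsRegularNorm.one_le {d : ℕ} {κ : ℝ} {M : Vec d → ℝ} {N : Seminorm ℝ (Vec d)}
    (h : IsRegularNorm κ M N) : 1 ≤ κ := by
  obtain ⟨κ', h1, h2, -⟩ := h
  exact h1.trans h2

lemma IsRegularNorm.isProbabilityMeasure {d : ℕ} {κ v : ℝ} {q : ENNReal} (hq : 1 ≤ q)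
    {N : Seminorm ℝ (Vec d)} (h : IsRegularNorm κ (lpNorm q) N) (hv : 0 ≤ v) :
    IsProbabilityMeasure (generalizedGaussian N 0 v) := by
  obtain ⟨κ', -, -, hs, hN⟩ := h
  -- `d + 1` rather than `d` avoids a zero denominator when `d = 0`.
  refine isProbabilityMeasure_generalizedGaussian hs.continuous hv
    (a := 1 / ((d : ℝ) + 1)) (by positivity) fun z => ?_
  rw [one_div, inv_mul_le_iff₀ (by positivity)]
  calc ‖z‖ ^ 2 ≤ d * lpNorm q z ^ 2 := norm_sq_le_lpNorm_sq hq z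
    _ ≤ d * N z ^ 2 := mul_le_mul_of_nonneg_left (hN z).1 (Nat.cast_nonneg d)
    _ ≤ (d + 1) * N z ^ 2 := by nlinarith [sq_nonneg (N z)]

/-- Privacy of releasing at most `K` values of common `ℓ_q` sensitivity `2 M`, each with
generalized Gaussian noise. -/
lemma pi_generalizedGaussian_shift_le {d : ℕ} {κ K M ε δ v : ℝ} {q : ENNReal} (hq : 1 ≤ q)
    {N : Seminorm ℝ (Vec d)} (hreg : IsRegularNorm κ (lpNorm q) N) (hK : 2 ≤ K)
    (hε : 0 < ε) (hδ : 0 < δ) (hδ1 : δ < 1) (hεδ : ε ≤ K * Real.log (K / δ)) (hM : 0 ≤ M)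
    (hv : v = 8 * K ^ 2 * κ * Real.log (K / δ) * M ^ 2 / ε ^ 2)
    {ι : Type*} [Fintype ι] (hι : (Fintype.card ι : ℝ) ≤ K) (w : Vec d)
    (hw : lpNorm q w ≤ 2 * M) (F : Set (ι → Vec d)) (hF : MeasurableSet F) :
    (Measure.pi fun _ : ι => generalizedGaussian N 0 v) {b | (fun i => b i + w) ∈ F}
      ≤ ENNReal.ofReal (Real.exp ε) * (Measure.pi fun _ : ι => generalizedGaussian N 0 v) F
        + ENNReal.ofReal δ := by
  have hκ := hreg.one_le
  set l := Real.log (K / δ) with hl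
  have hl0 : 0 < l := Real.log_pos ((one_lt_div hδ).2 (by linarith))
  -- For `M = 0` the noise is a point mass, but the shift vanishes as well.
  rcases hM.eq_or_lt with rfl | hM
  · have hw0 : w = 0 := eq_zero_of_lpNorm_le_zero hq (by simpa using hw)
    subst hw0
    simp only [add_zero]
    refine le_add_right (le_mul_of_one_le_left' ?_)
    rw [← ENNReal.ofReal_one]
    exact ENNReal.ofReal_le_ofReal (Real.one_le_exp hε.le)
  have hv0 : 0 < v := by rw [hv]; positivity
  have := hreg.isProbabilityMeasure hq hv0.le
  obtain ⟨κ', h1, -, hs, hN⟩ := hreg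
  have hB : κ' * N w ^ 2 ≤ κ * (2 * M) ^ 2 := by
    calc κ' * N w ^ 2 ≤ κ' * (κ / κ' * lpNorm q w ^ 2) :=
          mul_le_mul_of_nonneg_left (hN w).2 (by linarith)
      _ = κ * lpNorm q w ^ 2 := by field_simp
      _ ≤ _ := mul_le_mul_of_nonneg_left
          (pow_le_pow_left₀ (lpNorm_nonneg hq w) hw 2) (by linarith)
  -- With the Chernoff parameter `K * l / ε`, the exponent is at most `(K * l + ε) / 4 - K * l`.
  -- Since `ε ≤ K * l`, this is at most `-K * l / 2`, hence at most `-l` by `2 ≤ K`.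
  have hlam : 0 < K * l / ε := by positivity
  have hNc := hs.continuous
  refine pi_shift_le _ w (fun z => (N (z + w) ^ 2 - N z ^ 2) / (2 * v)) ?_
    (map_generalizedGaussian_withDensity hNc hv0 w) hlam
    (lintegral_exp_loss_le hs hv0 w hlam.le hB) ?_ F hF
  · have : Continuous fun z => (N (z + w) ^ 2 - N z ^ 2) / (2 * v) := by fun_prop
    exact this.measurable
  have hc : K * l / ε * (K * l / ε + 1) * (κ * (2 * M) ^ 2 / (2 * v))
      = (K * l + ε) / (4 * K) := by
    rw [hv]
    field_simp
    ring
  rw [hc]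
  have h2 : (Fintype.card ι : ℝ) * ((K * l + ε) / (4 * K)) ≤ K * ((K * l + ε) / (4 * K)) :=
    mul_le_mul_of_nonneg_right hι (by positivity)
  have h3 : K * ((K * l + ε) / (4 * K)) = (K * l + ε) / 4 := by field_simp
  have h4 : K * l / ε * ε = K * l := by field_simp
  calc Real.exp (Fintype.card ι * ((K * l + ε) / (4 * K)) - K * l / ε * ε)
      ≤ Real.exp (-l) := Real.exp_le_exp.2 (by nlinarith)
    _ = δ / K := by rw [hl, Real.exp_neg, Real.exp_log (by positivity), inv_div]
    _ ≤ δ := div_le_self hδ.le (by linarith)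

end DPTOFW

theorem mainTheorem2 {X : Type*} (d n : ℕ) (hn : 2 ≤ n)
    (p q : ENNReal) (hp : 1 < p) (hpq : ENNReal.HolderConjugate p q)
    (C : Set (DPTOFW.Vec d)) (hC : IsCompact C) (hconv : Convex ℝ C) (h0 : (0 : DPTOFW.Vec d) ∈ C)
    (D β L : ℝ) (hβ : 0 ≤ β)
    (hD : ∀ θ₁ ∈ C, ∀ θ₂ ∈ C, DPTOFW.lpNorm p (θ₁ - θ₂) ≤ D)
    (f : DPTOFW.Vec d → X → ℝ) (gradf : DPTOFW.Vec d → X → DPTOFW.Vec d)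
    (hgrad : ∀ x, ∀ θ ∈ C, HasGradientWithinAt (fun θ' => f θ' x) (gradf θ x) C θ)
    (hsmooth : ∀ x, ∀ θ₁ ∈ C, ∀ θ₂ ∈ C,
      DPTOFW.lpNorm q (gradf θ₁ x - gradf θ₂ x) ≤ β * DPTOFW.lpNorm p (θ₁ - θ₂))
    (hlip : ∀ x, ∀ θ ∈ C, DPTOFW.lpNorm q (gradf θ x) ≤ L)
    (κ : ℝ) (N : Seminorm ℝ (DPTOFW.Vec d))
    (hreg : DPTOFW.IsRegularNorm κ (DPTOFW.lpNorm q) N)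
    (lmo : DPTOFW.Vec d → DPTOFW.Vec d) (hlmo : DPTOFW.IsLinearMinimizer C lmo)
    (ε δ : ℝ) (hε : 0 < ε) (hδ : 0 < δ) (hδ1 : δ < 1)
    (hεδ : ε ≤ ((DPTOFW.height n : ℝ) + 1) * Real.log (((DPTOFW.height n : ℝ) + 1) / δ)) :
    DPTOFW.IsDP (n := n) (DPTOFW.tofw gradf lmo N (DPTOFW.noiseLevel n κ β D L ε δ)) ε δ := by
  have hp1 : 1 ≤ p := hp.le
  have hq1 : 1 ≤ q := hpq.symm.one_le
  have hK : (2 : ℝ) ≤ (DPTOFW.height n : ℝ) + 1 := by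
    have h : 1 ≤ DPTOFW.height n := Nat.clog_pos one_lt_two hn
    have h' : (1 : ℝ) ≤ DPTOFW.height n := by exact_mod_cast h
    linarith
  have hκ := hreg.one_le
  have hl : 0 ≤ Real.log (((DPTOFW.height n : ℝ) + 1) / δ) :=
    Real.log_nonneg ((one_le_div hδ).2 (by linarith))
  have hv : 0 ≤ DPTOFW.noiseLevel n κ β D L ε δ := by
    rw [DPTOFW.noiseLevel]
    positivity
  have hprob := hreg.isProbabilityMeasure hq1 hv
  have hmeas := fun x : Fin n → X => DPTOFW.measurable_iterates gradf lmo hconv h0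
    (fun g => (hlmo.2 g).1) hlmo.1
    (fun z => DPTOFW.continuousOn_of_lpNorm_sub_le hp1 hq1 (hsmooth z)) x
  refine ⟨fun x => ?_, fun x x' ⟨i, hi⟩ S hS => ?_⟩
  · have : IsProbabilityMeasure
        (DPTOFW.noiseLaw (d := d) n N (DPTOFW.noiseLevel n κ β D L ε δ)) := by
      unfold DPTOFW.noiseLaw
      infer_instance
    exact Measure.isProbabilityMeasure_map (hmeas x).aemeasurable
  have hinc := DPTOFW.lpNorm_incrementAt_le (n := n) hp1 hq1 hconv h0 hβ hD gradf lmo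
    (fun g => (hlmo.2 g).1) hsmooth hlip x
  have hM : 0 ≤ β * D + L := (DPTOFW.lpNorm_nonneg hq1 _).trans (hinc 0 i (x i))
  rw [DPTOFW.tofw, DPTOFW.tofw, Measure.map_apply (hmeas x) hS, Measure.map_apply (hmeas x') hS]
  refine DPTOFW.pi_adaptive_shift_le _ (DPTOFW.IsPathNoise (i : ℕ))
    (fun ω => DPTOFW.incrementAt gradf lmo x ω i (x i)
      - DPTOFW.incrementAt gradf lmo x ω i (x' i))
    (fun ω F hF => ?_) (fun ω ω' hω => ?_) _ _ (hmeas x hS) (hmeas x' hS) fun ω hω => ?_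
  · refine DPTOFW.pi_generalizedGaussian_shift_le hq1 hreg hK hε hδ hδ1 hεδ hM rfl ?_ _ ?_ F hF
    · exact_mod_cast DPTOFW.card_isPathNoise_le (i : ℕ)
    · linarith [DPTOFW.lpNorm_sub_le hq1 (DPTOFW.incrementAt gradf lmo x ω i (x i))
        (DPTOFW.incrementAt gradf lmo x ω i (x' i)), hinc ω i (x i), hinc ω i (x' i)]
  -- Draws before time `i + 1` are never path draws, so agreement off the path fixes the run up to
  -- the increment.
  · have h := DPTOFW.run_congr gradf lmo x ω ω' i i.2.le fun c hc =>
      hω c fun hc' => absurd hc'.le (by omega)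
    simp only [DPTOFW.incrementAt, h]
  · have h := DPTOFW.iterates_shiftNoise gradf lmo x x' i hi ω _ rfl
    change DPTOFW.iterates gradf lmo x' (DPTOFW.shiftNoise i _ ω) ∈ S
    rw [h]
    exact hω
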